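/- Let $X$ be a finite domain, let $\mathcal D$ be a distribution on $X$, and let $\eta,\varepsilon\in(0,1)$. **Oblivious (Huber) additive contamination.** For $f:X^n\to\{0,1\}$ put $$\mathrm{ObliviousAddMax}_\eta(f,\mathcal D)=\sup_{\mathcal D'}\ \mathbb E_{S'\sim(\mathcal D')^n}[f(S')],$$ where the supremum is over all mixtures $\mathcal D'=(1-\eta)\mathcal D+\eta\mathcal E$ with $\mathcal E$ an arbitrary distribution on $X$. **Adaptive additive contamination.** For $S\in X^{\lceil(1-\eta)m\rceil}$ let $\mathrm{add}_\eta(S)\subseteq X^m$ be the set of all samples obtained by adding $\lfloor\eta m\rfloor$ arbitrary points of $X$ to $S$ and then arbitrarily permuting the result. For a (possibly randomized) function $F:X^m\to\{0,1\}$ put $$\mathrm{AdaptiveAddMax}_\eta(F,\mathcal D)=\mathbb E_{S\sim\mathcal D^{\lceil(1-\eta)m\rceil}}\Big[\sup_{S'\in\mathrm{add}_\eta(S)}\mathbb E[F(S')]\Big],$$ the inner expectation being over the randomness of $F$. **Subsampling.** For $n\le m$, $\Phi_{m\to n}:X^m\to X^n$ is the randomized map that returns $n$ points drawn uniformly without replacement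 from its input. **Theorem.** There is a polynomial $P$ such that for every finite $X$, every $n\in\mathbb N$, all $\eta,\varepsilon\in(0,1)$ and every integer $m\ge P(n,1/\varepsilon,\ln|X|)$, one has $m\ge n$ and, for every $f:X^n\to\{0,1\}$ and every distribution $\mathcal D$ on $X$, $$\big|\mathrm{ObliviousAddMax}_\eta(f,\mathcal D)-\mathrm{AdaptiveAddMax}_\eta(f\circ\Phi_{m\to n},\mathcal D)\big|\le\varepsilon .$$ In particular $m$ can be taken polynomial in $n$, $1/\varepsilon$ and $\ln|X|$, independently of $\eta$, $f$ and $\mathcal D$. -/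

import Mathlib

noncomputable section

namespace AdditiveContamination

universe u

variable {X : Type u}

/-- Expectation of a real function under a distribution on a finite type. -/
def expect {α : Type*} [Fintype α] (p : PMF α) (g : α → ℝ) : ℝ :=
  ∑ a, (p a).toReal * g a

/-- The product distribution `D^k` on `X^k`: `k` i.i.d. draws from `D`. -/
def iid [Fintype X] (D : PMF X) (k : ℕ) : PMF (Fin k → X) :=
  PMF.ofFintype (fun S => ∏ i, D (S i)) (by
    have hD : ∑ x, D x = 1 := by rw [← tsum_fintype (L := .unconditional X)]; exact D.tsum_coe
    have h := Fintype.sum_pow (fun x => D x) k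
    rw [hD, one_pow] at h
    exact h.symm)

/-- The subsampling filter from `X^m` to `X^n`: `n` points drawn uniformly without replacement,
i.e. the entries of the sample along a uniformly random injection of index sets. -/
def subsample {n m : ℕ} (h : n ≤ m) (S : Fin m → X) : PMF (Fin n → X) :=
  haveI : Nonempty (Fin n ↪ Fin m) := ⟨Fin.castLEEmb h⟩
  (PMF.uniformOfFintype (Fin n ↪ Fin m)).map (fun φ i => S (φ i))

/-- A randomized function from `X^m` to `{0,1}`: each input gives a distribution on outputs. -/
abbrev RandomizedTest (X : Type u) (m : ℕ) := (Fin m → X) → PMF Bool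

/-- The randomized function obtained by running `f` on a random subsample of the input. -/
def compSubsample {n m : ℕ} (f : (Fin n → X) → Bool) (h : n ≤ m) : RandomizedTest X m :=
  fun S => (subsample h S).map f

/-- Oblivious (Huber) contaminations of `D`: all mixtures `(1 - η) D + η E`, where `E` is an
arbitrary distribution. -/
def obliviousAdd (η : ℝ) (D : PMF X) : Set (PMF X) :=
  {D' | ∃ E : PMF X, ∀ x, (D' x).toReal = (1 - η) * (D x).toReal + η * (E x).toReal}

/-- The largest acceptance probability of `f` on i.i.d. samples from a contamination of `D`. -/
def obliviousAddMax [Fintype X] {n : ℕ} (η : ℝ) (f : (Fin n → X) → Bool) (D : PMF X) : ℝ :=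
  ⨆ D' : obliviousAdd η D, expect (iid (D' : PMF X) n) (fun S' => if f S' then 1 else 0)

/-- Adaptive contaminations of a sample `S` of `⌈(1 - η) m⌉` points: samples of `m` points obtained
by adding `⌊η m⌋` arbitrary points `T` to `S` and permuting the result arbitrarily. -/
def adaptiveAdd (η : ℝ) (m : ℕ) (S : Fin ⌈(1 - η) * m⌉₊ → X) : Set (Fin m → X) :=
  {S' | ∃ (T : Fin ⌊η * m⌋₊ → X) (σ : Fin m ≃ Fin ⌈(1 - η) * m⌉₊ ⊕ Fin ⌊η * m⌋₊),
    S' = fun i => Sum.elim S T (σ i)}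

/-- The expectation, over a clean i.i.d. sample of `⌈(1 - η) m⌉` points, of the largest acceptance
probability (over the randomness of `F`) on an adaptive contamination of that sample. -/
def adaptiveAddMax [Fintype X] {m : ℕ} (η : ℝ) (F : RandomizedTest X m) (D : PMF X) : ℝ :=
  expect (iid D ⌈(1 - η) * m⌉₊)
    (fun S => ⨆ S' : adaptiveAdd η m S, (F (S' : Fin m → X) true).toReal)

end AdditiveContamination

end

/-!
Write `acceptProb f p` for the acceptance probability of `f` on `n` independent draws from the
weight function `p`. The oblivious value is the supremum of `acceptProb f` over the mixtures
`(1 - η) D + η E`, while, up to `n² / m`, a subsample of a contaminated sample behaves like `n`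
independent draws from the empirical distribution of that sample
(`abs_expect_embedding_sub_le`). Let `k` be the number of clean points and `l` that of added ones.

Everything rests on one resampling estimate, `abs_prodExpect_blend_sub_le`: replacing an empirical
distribution by the distribution its points were drawn from changes the expected acceptance
probability by at most the probability that two of the `n` draws hit the same sample point.

* The adaptive adversary is at least as strong as the oblivious one, since it can add `l`
  independent draws from `E`; some outcome of these draws does at least as well as the average
  (`obliviousAddMax_le_adaptiveAddMax`).
* For the converse, the added points `T` depend on the clean sample `S`, and there are `|X| ^ l`
  choices for them, too many for a union bound when `m` is to be independent of `η`. But the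
  estimate, applied to draws from the empirical distribution of `T` with `S` held fixed, shows that
  `T` may be replaced by `r ≈ n² / ε` points `T'`, each taken with weight `l / (m r)`
  (`exists_compSubsample_le_acceptProb_blend`). For a fixed `T'`, the acceptance probability as a
  function of `S` changes by at most `2 n / m` when one clean point changes, so McDiarmid's
  inequality applies, and the maximal inequality `prodExpect_le_of_forall_exists_le` bounds the
  expected maximum over all `|X| ^ r` choices of `T'`. By the estimate once more, the expectation
  for a fixed `T'` is close to the acceptance probability under an oblivious contamination with
  noise uniform on `T'` (`adaptiveAddMax_le_obliviousAddMax`).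
-/

namespace AdditiveContamination

open Finset

/-! ### Expectations under product distributions -/

section ProductExpectation

variable {ι κ α : Type*} [Fintype ι] [Fintype κ] [Fintype α]

lemma prod_weight_nonneg {p : ι → α → ℝ} (hp : ∀ i, p i ∈ stdSimplex ℝ α) (x : ι → α) :
    0 ≤ ∏ i, p i (x i) :=
  Finset.prod_nonneg fun i _ => (hp i).1 _

variable [DecidableEq ι]

/-- The expectation of `g` under the product distribution with marginals `p i`. Distributions on a
finite type are encoded by their weight functions, i.e. as elements of `stdSimplex ℝ α`. -/
def prodExpect (p : ι → α → ℝ) (g : (ι → α) → ℝ) : ℝ :=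
  ∑ x : ι → α, (∏ i, p i (x i)) * g x

lemma sum_prod_eq_one {p : ι → α → ℝ} (hp : ∀ i, p i ∈ stdSimplex ℝ α) :
    ∑ x : ι → α, ∏ i, p i (x i) = 1 := by
  rw [← Fintype.piFinset_univ, ← Finset.prod_univ_sum]
  exact Finset.prod_eq_one fun i _ => (hp i).2

lemma prodExpect_mono {p : ι → α → ℝ} (hp : ∀ i, p i ∈ stdSimplex ℝ α) {g h : (ι → α) → ℝ}
    (hgh : ∀ x, g x ≤ h x) : prodExpect p g ≤ prodExpect p h :=
  Finset.sum_le_sum fun x _ => mul_le_mul_of_nonneg_left (hgh x) (prod_weight_nonneg hp x)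

lemma prodExpect_const {p : ι → α → ℝ} (hp : ∀ i, p i ∈ stdSimplex ℝ α) (c : ℝ) :
    prodExpect p (fun _ => c) = c := by
  rw [prodExpect, ← Finset.sum_mul, sum_prod_eq_one hp, one_mul]

lemma prodExpect_add (p : ι → α → ℝ) (g h : (ι → α) → ℝ) :
    prodExpect p (fun x => g x + h x) = prodExpect p g + prodExpect p h := by
  simp only [prodExpect, mul_add, Finset.sum_add_distrib]

lemma prodExpect_sub (p : ι → α → ℝ) (g h : (ι → α) → ℝ) :
    prodExpect p (fun x => g x - h x) = prodExpect p g - prodExpect p h := by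
  simp only [prodExpect, mul_sub, Finset.sum_sub_distrib]

lemma prodExpect_const_mul (p : ι → α → ℝ) (c : ℝ) (g : (ι → α) → ℝ) :
    prodExpect p (fun x => c * g x) = c * prodExpect p g := by
  simp only [prodExpect, Finset.mul_sum, mul_left_comm]

lemma prodExpect_sum {τ : Type*} (s : Finset τ) (p : ι → α → ℝ) (g : τ → (ι → α) → ℝ) :
    prodExpect p (fun x => ∑ t ∈ s, g t x) = ∑ t ∈ s, prodExpect p (g t) := by
  simp only [prodExpect, Finset.mul_sum]
  rw [Finset.sum_comm]

lemma prodExpect_nonneg {p : ι → α → ℝ} (hp : ∀ i, p i ∈ stdSimplex ℝ α) {g : (ι → α) → ℝ}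
    (hg : ∀ x, 0 ≤ g x) : 0 ≤ prodExpect p g :=
  Finset.sum_nonneg fun x _ => mul_nonneg (prod_weight_nonneg hp x) (hg x)

lemma exists_prodExpect_le {p : ι → α → ℝ} (hp : ∀ i, p i ∈ stdSimplex ℝ α)
    (g : (ι → α) → ℝ) : ∃ x, prodExpect p g ≤ g x := by
  have : Nonempty (ι → α) := by
    by_contra h
    have := not_nonempty_iff.1 h
    simpa using sum_prod_eq_one hp
  obtain ⟨x, hx⟩ := Finite.exists_max g
  exact ⟨x, (prodExpect_mono hp hx).trans_eq (prodExpect_const hp _)⟩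

lemma prodExpect_mem_Icc {p : ι → α → ℝ} (hp : ∀ i, p i ∈ stdSimplex ℝ α) {g : (ι → α) → ℝ}
    (hg : ∀ x, g x ∈ Set.Icc (0 : ℝ) 1) : prodExpect p g ∈ Set.Icc (0 : ℝ) 1 := by
  refine ⟨prodExpect_nonneg hp fun x => (hg x).1, ?_⟩
  rw [← prodExpect_const hp 1]
  exact prodExpect_mono hp fun x => (hg x).2

lemma prodExpect_single [DecidableEq α] (z : ι → α) (g : (ι → α) → ℝ) :
    prodExpect (fun i => Pi.single (z i) 1) g = g z := by
  rw [prodExpect, Finset.sum_eq_single z]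
  · simp
  · intro x _ hx
    obtain ⟨i, hi⟩ := Function.ne_iff.1 hx
    rw [Finset.prod_eq_zero (Finset.mem_univ i) (by simp [hi]), zero_mul]
  · simp

/-- Drawing from a mixture amounts to drawing a component and then drawing from it. -/
lemma prodExpect_mixture (w : κ → ℝ) (p : κ → α → ℝ) (g : (ι → α) → ℝ) :
    prodExpect (fun _ : ι => fun a => ∑ i, w i * p i a) g
      = prodExpect (fun _ : ι => w) (fun φ => prodExpect (fun j => p (φ j)) g) := by
  simp only [prodExpect, Finset.prod_univ_sum, Fintype.piFinset_univ, Finset.mul_sum,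
    Finset.sum_mul, Finset.prod_mul_distrib]
  rw [Finset.sum_comm]
  simp only [mul_assoc]

variable [DecidableEq κ]

lemma prodExpect_sumElim (p : ι → α → ℝ) (q : κ → α → ℝ) (g : (ι ⊕ κ → α) → ℝ) :
    prodExpect (Sum.elim p q) g
      = prodExpect p (fun S => prodExpect q (fun T => g (Sum.elim S T))) := by
  simp only [prodExpect, Finset.mul_sum]
  rw [← Fintype.sum_prod_type']
  refine Fintype.sum_equiv (Equiv.sumArrowEquivProdArrow ι κ α) _ _ fun x => ?_
  have : Sum.elim (x ∘ Sum.inl) (x ∘ Sum.inr) = x := Sum.elim_comp_inl_inr x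
  simp [Equiv.sumArrowEquivProdArrow, Fintype.prod_sum_type, this, mul_assoc]

lemma prodExpect_succ {k : ℕ} (p : α → ℝ) (g : (Fin (k + 1) → α) → ℝ) :
    prodExpect (fun _ => p) g
      = ∑ a, p a * prodExpect (fun _ : Fin k => p) (fun x => g (Fin.cons a x)) := by
  simp only [prodExpect, Finset.mul_sum]
  rw [← Fintype.sum_prod_type']
  refine (Fintype.sum_equiv (Fin.consEquiv fun _ : Fin (k + 1) => α) _ _ fun x => ?_).symm
  simp [Fin.consEquiv, Fin.prod_univ_succ, mul_assoc]

/-- The marginal of a product distribution along an injection of index sets is a product. -/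
lemma prodExpect_comp_injective {p : ι → α → ℝ} (hp : ∀ i, p i ∈ stdSimplex ℝ α) {φ : κ → ι}
    (hφ : Function.Injective φ) (g : (κ → α) → ℝ) :
    prodExpect p (fun x => g (x ∘ φ)) = prodExpect (fun j => p (φ j)) g := by
  classical
  have key : ∀ y : κ → α,
      ∑ x : ι → α, (∏ i, p i (x i)) * (if x ∘ φ = y then 1 else 0) = ∏ j, p (φ j) (y j) := by
    intro y
    -- the constraint `x ∘ φ = y` is a product of constraints on single coordinates
    have h1 : ∀ x : ι → α, (∏ i, p i (x i)) * (if x ∘ φ = y then (1 : ℝ) else 0)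
        = ∏ i, p i (x i) * (if ∀ j, φ j = i → x i = y j then 1 else 0) := by
      intro x
      rw [Finset.prod_mul_distrib, Finset.prod_boole]
      congr 2
      simp only [funext_iff, Function.comp_apply, Finset.mem_univ, true_implies]
      exact propext ⟨fun h i j hj => hj ▸ h j, fun h j => h _ j rfl⟩
    simp only [h1]
    rw [← Fintype.piFinset_univ,
      ← Finset.prod_univ_sum (fun _ => Finset.univ)
        (fun i a => p i a * (if ∀ j, φ j = i → a = y j then 1 else 0))]
    symm
    refine Finset.prod_of_injOn φ hφ.injOn (by simp) ?_ ?_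
    · intro i _ hi
      have : ∀ j, φ j ≠ i := by simpa using hi
      simpa [this] using (hp i).2
    · intro j _
      rw [Finset.sum_eq_single (y j)]
      · rw [if_pos, mul_one]
        intro j' hj'
        rw [hφ hj']
      · intro b _ hb
        rw [if_neg (fun h => hb (h j rfl)), mul_zero]
      · simp
  have h2 : ∀ x : ι → α, g (x ∘ φ) = ∑ y, g y * (if x ∘ φ = y then 1 else 0) := by simp
  calc prodExpect p (fun x => g (x ∘ φ))
      = ∑ y, g y * ∑ x : ι → α, (∏ i, p i (x i)) * (if x ∘ φ = y then 1 else 0) := by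
        simp only [prodExpect, h2, Finset.mul_sum]
        rw [Finset.sum_comm]
        exact Finset.sum_congr rfl fun y _ => Finset.sum_congr rfl fun x _ => by ring
    _ = prodExpect (fun j => p (φ j)) g := by
        simp only [key, prodExpect, mul_comm]

end ProductExpectation

/-! ### Collisions -/

section Collisions

variable {ι α : Type*} [Fintype ι] [DecidableEq ι] [Fintype α] {n : ℕ}

/-- Two of `n` independent draws from `w` collide with probability at most `n² ∑ w²`. -/
lemma prodExpect_not_injective_le {w : ι → ℝ} (hw : w ∈ stdSimplex ℝ ι) :
    prodExpect (fun _ : Fin n => w) (fun φ => if Function.Injective φ then 0 else 1)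
      ≤ (n : ℝ) ^ 2 * ∑ i, w i ^ 2 := by
  have pair : ∀ a b : Fin n, a ≠ b →
      prodExpect (fun _ : Fin n => w) (fun φ => if φ a = φ b then 1 else 0) = ∑ i, w i ^ 2 := by
    intro a b hab
    have hinj : Function.Injective ![a, b] := by
      intro i j
      fin_cases i <;> fin_cases j <;> simp [hab, hab.symm]
    refine (prodExpect_comp_injective (fun _ => hw) hinj
      (fun y : Fin 2 → ι => if y 0 = y 1 then (1 : ℝ) else 0)).trans ?_
    rw [prodExpect, Fintype.sum_equiv (finTwoArrowEquiv ι) _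
      (fun z => w z.1 * w z.2 * if z.1 = z.2 then 1 else 0) (by simp [Fin.prod_univ_two]),
      Fintype.sum_prod_type]
    simp [sq]
  calc prodExpect (fun _ : Fin n => w) (fun φ => if Function.Injective φ then 0 else 1)
      ≤ prodExpect (fun _ : Fin n => w)
          (fun φ => ∑ z ∈ univ.filter (fun z : Fin n × Fin n => z.1 ≠ z.2),
            if φ z.1 = φ z.2 then 1 else 0) := by
        refine prodExpect_mono (fun _ => hw) fun φ => ?_
        split_ifs with h
        · exact Finset.sum_nonneg fun z _ => by split_ifs <;> norm_num
        · simp only [Function.Injective, not_forall] at h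
          obtain ⟨a, b, hab, hne⟩ := h
          have hmem : (a, b) ∈ univ.filter (fun z : Fin n × Fin n => z.1 ≠ z.2) := by
            simpa using hne
          have := Finset.single_le_sum
            (f := fun z : Fin n × Fin n => if φ z.1 = φ z.2 then (1 : ℝ) else 0)
            (fun z _ => by positivity)
            hmem
          simpa [hab] using this
    _ = ∑ z ∈ univ.filter (fun z : Fin n × Fin n => z.1 ≠ z.2), ∑ i, w i ^ 2 := by
        rw [prodExpect_sum]
        exact Finset.sum_congr rfl fun z hz => pair _ _ (Finset.mem_filter.1 hz).2
    _ ≤ ∑ z : Fin n × Fin n, ∑ i, w i ^ 2 :=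
        Finset.sum_le_sum_of_subset_of_nonneg (Finset.filter_subset _ _)
          fun _ _ _ => Finset.sum_nonneg fun i _ => sq_nonneg _
    _ = (n : ℝ) ^ 2 * ∑ i, w i ^ 2 := by
        simp [sq]

/-- Resampling. Let `Z i ∼ p i` be independent. Drawing `n` indices from `w` and reading off the
values of `Z` there is nearly the same as drawing `n` points from the mixture `∑ w i • p i`: the two
experiments agree as long as no index is drawn twice. -/
lemma abs_prodExpect_resample_sub_le [DecidableEq α] {w : ι → ℝ} (hw : w ∈ stdSimplex ℝ ι)
    {p : ι → α → ℝ} (hp : ∀ i, p i ∈ stdSimplex ℝ α) {g : (Fin n → α) → ℝ}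
    (hg : ∀ x, g x ∈ Set.Icc (0 : ℝ) 1) :
    |prodExpect p (fun Z => prodExpect (fun _ : Fin n => fun a =>
          ∑ i, w i * (Pi.single (Z i) 1 : α → ℝ) a) g)
        - prodExpect (fun _ : Fin n => fun a => ∑ i, w i * p i a) g|
      ≤ (n : ℝ) ^ 2 * ∑ i, w i ^ 2 := by
  have h1 : prodExpect p (fun Z => prodExpect (fun _ : Fin n => fun a =>
        ∑ i, w i * (Pi.single (Z i) 1 : α → ℝ) a) g)
      = prodExpect (fun _ : Fin n => w) (fun φ => prodExpect p (fun Z => g (Z ∘ φ))) := by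
    have : ∀ Z : ι → α, prodExpect (fun _ : Fin n => fun a =>
        ∑ i, w i * (Pi.single (Z i) 1 : α → ℝ) a) g
        = prodExpect (fun _ : Fin n => w) (fun φ => g (Z ∘ φ)) := by
      intro Z
      rw [prodExpect_mixture w (fun i => Pi.single (Z i) 1) g]
      congr 1
      funext φ
      exact prodExpect_single (Z ∘ φ) g
    simp only [this]
    unfold prodExpect
    simp only [Finset.mul_sum]
    rw [Finset.sum_comm]
    exact Finset.sum_congr rfl fun y _ => Finset.sum_congr rfl fun x _ => by ring
  rw [h1, prodExpect_mixture, ← prodExpect_sub]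
  have hdiff : ∀ φ : Fin n → ι,
      |prodExpect p (fun Z => g (Z ∘ φ)) - prodExpect (fun j => p (φ j)) g|
        ≤ if Function.Injective φ then 0 else 1 := by
    intro φ
    split_ifs with h
    · rw [prodExpect_comp_injective hp h, sub_self, abs_zero]
    · have a := prodExpect_mem_Icc hp (g := fun Z => g (Z ∘ φ)) fun x => hg _
      have b := prodExpect_mem_Icc (fun j => hp (φ j)) hg
      rw [abs_le]
      constructor <;> linarith [a.1, a.2, b.1, b.2]
  refine le_trans ?_ (prodExpect_not_injective_le hw)
  rw [abs_le]
  constructor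
  · have := prodExpect_mono (fun _ : Fin n => hw) fun φ => (abs_le.1 (hdiff φ)).1
    rw [← neg_one_mul, ← prodExpect_const_mul]
    simpa only [neg_one_mul] using this
  · exact prodExpect_mono (fun _ : Fin n => hw) fun φ => (abs_le.1 (hdiff φ)).2

/-- Sampling without replacement is within `n² / m` of sampling with replacement. -/
lemma abs_expect_embedding_sub_le {m : ℕ} (hm : 0 < m) (hnm : n ≤ m) {g : (Fin n → Fin m) → ℝ}
    (hg : ∀ x, g x ∈ Set.Icc (0 : ℝ) 1) :
    |(∑ φ : Fin n ↪ Fin m, g φ) / Fintype.card (Fin n ↪ Fin m)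
        - prodExpect (fun _ : Fin n => fun _ : Fin m => 1 / (m : ℝ)) g| ≤ (n : ℝ) ^ 2 / m := by
  classical
  have hm' : (0 : ℝ) < m := by exact_mod_cast hm
  have hw : (fun _ : Fin m => 1 / (m : ℝ)) ∈ stdSimplex ℝ (Fin m) :=
    ⟨fun _ => by positivity, by simp [hm'.ne']⟩
  have hcol := prodExpect_not_injective_le (n := n) hw
  have hsq : (n : ℝ) ^ 2 * ∑ _i : Fin m, (1 / (m : ℝ)) ^ 2 = (n : ℝ) ^ 2 / m := by
    simp; field_simp
  rw [hsq] at hcol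
  refine le_trans ?_ hcol
  have hN : (0 : ℝ) < Fintype.card (Fin n ↪ Fin m) := by
    have : Nonempty (Fin n ↪ Fin m) := ⟨Fin.castLEEmb hnm⟩
    exact_mod_cast Fintype.card_pos
  have hsumemb : ∀ u : (Fin n → Fin m) → ℝ,
      ∑ φ, (if Function.Injective φ then u φ else 0) = ∑ φ : Fin n ↪ Fin m, u φ := by
    intro u
    rw [← Finset.sum_filter, Finset.sum_subtype (p := Function.Injective) _ (by simp) u]
    exact Fintype.sum_equiv (Equiv.subtypeInjectiveEquivEmbedding _ _) _ _ fun x => rfl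
  -- `c` is the weight of a single map, so that `c * N = 1 - δ` is the probability of injectivity
  set c : ℝ := (1 / (m : ℝ)) ^ n with hc
  have hc0 : 0 ≤ c := by positivity
  set δ := prodExpect (fun _ : Fin n => fun _ : Fin m => 1 / (m : ℝ))
    (fun φ => if Function.Injective φ then 0 else 1) with hδ
  set N : ℝ := (Fintype.card (Fin n ↪ Fin m) : ℝ) with hNdef
  have hdecomp : ∀ u : (Fin n → Fin m) → ℝ,
      prodExpect (fun _ : Fin n => fun _ : Fin m => 1 / (m : ℝ)) u
        = c * ∑ φ : Fin n ↪ Fin m, u φ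
          + prodExpect (fun _ : Fin n => fun _ : Fin m => 1 / (m : ℝ))
              (fun φ => if Function.Injective φ then 0 else u φ) := by
    intro u
    rw [← hsumemb u]
    simp only [prodExpect, Finset.prod_const, Finset.card_univ, Fintype.card_fin, ← hc,
      ← Finset.mul_sum, ← mul_add, ← Finset.sum_add_distrib]
    congr 1
    exact Finset.sum_congr rfl fun φ _ => by split_ifs <;> simp
  have hone := hdecomp fun _ => 1
  rw [prodExpect_const (fun _ => hw), ← hδ, Finset.sum_const, Finset.card_univ, nsmul_eq_mul,
    mul_one, ← hNdef] at hone
  have hb0 : 0 ≤ prodExpect (fun _ : Fin n => fun _ : Fin m => 1 / (m : ℝ))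
      (fun φ => if Function.Injective φ then 0 else g φ) :=
    prodExpect_nonneg (fun _ => hw) fun φ => by
      split_ifs
      exacts [le_rfl, (hg φ).1]
  have hb1 : prodExpect (fun _ : Fin n => fun _ : Fin m => 1 / (m : ℝ))
      (fun φ => if Function.Injective φ then 0 else g φ) ≤ δ :=
    prodExpect_mono (fun _ => hw) fun φ => by
      split_ifs
      exacts [le_rfl, (hg φ).2]
  rw [hdecomp g]
  set s := ∑ φ : Fin n ↪ Fin m, g φ
  have hs0 : 0 ≤ s / N := div_nonneg (Finset.sum_nonneg fun φ _ => (hg _).1) hN.le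
  have hs1 : s / N ≤ 1 := by
    rw [div_le_one hN]
    calc s ≤ ∑ _φ : Fin n ↪ Fin m, (1 : ℝ) := Finset.sum_le_sum fun φ _ => (hg _).2
      _ = N := by simp [hNdef]
  have hcs : c * s = s / N * (1 - δ) := by
    have : 1 - δ = c * N := by linarith
    rw [this]; field_simp
  have hδ0 : 0 ≤ δ := hb0.trans hb1
  rw [hcs, abs_le]
  constructor <;> nlinarith [mul_nonneg hs0 hδ0, mul_nonneg (sub_nonneg.2 hs1) hδ0]

end Collisions

/-! ### Bounded differences -/

section Concentration

variable {α : Type*} [Fintype α] {n : ℕ}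

/-- Replacing `p` by `q` in the `n`-fold product changes the expectation of a `[0, 1]`-valued
function by at most `n` times the `ℓ¹` distance of `p` and `q`. -/
lemma abs_prodExpect_sub_le {p q : α → ℝ} (hp : p ∈ stdSimplex ℝ α) (hq : q ∈ stdSimplex ℝ α)
    {g : (Fin n → α) → ℝ} (hg : ∀ x, g x ∈ Set.Icc (0 : ℝ) 1) :
    |prodExpect (fun _ => p) g - prodExpect (fun _ => q) g| ≤ n * ∑ a, |p a - q a| := by
  induction n with
  | zero => simp [prodExpect]
  | succ n ih =>
    rw [prodExpect_succ, prodExpect_succ, ← Finset.sum_sub_distrib]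
    calc |∑ a, (p a * prodExpect (fun _ => p) (fun x => g (Fin.cons a x))
            - q a * prodExpect (fun _ => q) (fun x => g (Fin.cons a x)))|
        ≤ ∑ a, (|p a - q a| + q a * (n * ∑ a, |p a - q a|)) := by
          refine (Finset.abs_sum_le_sum_abs _ _).trans (Finset.sum_le_sum fun a _ => ?_)
          have h1 := ih (g := fun x => g (Fin.cons a x)) fun x => hg _
          have h2 := prodExpect_mem_Icc (fun _ : Fin n => hp)
            (g := fun x => g (Fin.cons a x)) fun x => hg _
          set u := prodExpect (fun _ : Fin n => p) (fun x => g (Fin.cons a x))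
          set v := prodExpect (fun _ : Fin n => q) (fun x => g (Fin.cons a x))
          calc |p a * u - q a * v| = |(p a - q a) * u + q a * (u - v)| := by ring_nf
            _ ≤ |(p a - q a) * u| + |q a * (u - v)| := abs_add_le _ _
            _ = |p a - q a| * u + q a * |u - v| := by
              rw [abs_mul, abs_mul, abs_of_nonneg h2.1, abs_of_nonneg (hq.1 a)]
            _ ≤ |p a - q a| + q a * (n * ∑ a, |p a - q a|) := by
              have := mul_le_mul_of_nonneg_left h1 (hq.1 a)
              have := mul_le_mul_of_nonneg_left h2.2 (abs_nonneg (p a - q a))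
              linarith
      _ = (n + 1 : ℕ) * ∑ a, |p a - q a| := by
          rw [Finset.sum_add_distrib, ← Finset.sum_mul, hq.2]
          push_cast
          ring

/-- Hoeffding's lemma, with a non-optimal constant. -/
lemma sum_mul_exp_centered_le {p : α → ℝ} (hp : p ∈ stdSimplex ℝ α) {h : α → ℝ} {c : ℝ}
    (hc : ∀ a b, |h a - h b| ≤ c) (t : ℝ) :
    ∑ a, p a * Real.exp (t * (h a - ∑ b, p b * h b)) ≤ Real.exp ((t * c) ^ 2 / 2) := by
  set μ := ∑ b, p b * h b with hμ
  have hdev : ∀ a, |h a - μ| ≤ c := by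
    intro a
    have : h a - μ = ∑ b, p b * (h a - h b) := by
      simp only [mul_sub, Finset.sum_sub_distrib, ← Finset.sum_mul, hp.2, one_mul, hμ]
    rw [this]
    calc |∑ b, p b * (h a - h b)| ≤ ∑ b, p b * c := by
          refine (Finset.abs_sum_le_sum_abs _ _).trans (Finset.sum_le_sum fun b _ => ?_)
          rw [abs_mul, abs_of_nonneg (hp.1 b)]
          exact mul_le_mul_of_nonneg_left (hc a b) (hp.1 b)
      _ = c := by rw [← Finset.sum_mul, hp.2, one_mul]
  have hmean : ∑ a, p a * ((h a - μ) / c) = 0 := by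
    simp only [← mul_div_assoc, ← Finset.sum_div, mul_sub, Finset.sum_sub_distrib,
      ← Finset.sum_mul, hp.2, one_mul, ← hμ, sub_self, zero_div]
  -- convexity of `exp` on `[-t c, t c]`
  have hpt : ∀ a, Real.exp (t * (h a - μ))
      ≤ Real.cosh (t * c) + (h a - μ) / c * Real.sinh (t * c) := by
    intro a
    have hc0 : 0 ≤ c := (abs_nonneg _).trans (hdev a)
    have heq : t * (h a - μ) = (h a - μ) / c * (t * c) := by
      rcases hc0.eq_or_lt with h0 | h0
      · have := hdev a
        rw [← h0, abs_nonpos_iff] at this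
        simp [this]
      · field_simp
    rw [heq]
    refine Real.exp_mul_le_cosh_add_mul_sinh ?_ _
    rw [abs_div, abs_of_nonneg hc0]
    exact div_le_one_of_le₀ (hdev a) hc0
  calc ∑ a, p a * Real.exp (t * (h a - μ))
      ≤ ∑ a, p a * (Real.cosh (t * c) + (h a - μ) / c * Real.sinh (t * c)) :=
        Finset.sum_le_sum fun a _ => mul_le_mul_of_nonneg_left (hpt a) (hp.1 a)
    _ = Real.cosh (t * c) := by
        simp only [mul_add, Finset.sum_add_distrib, ← Finset.sum_mul, hp.2, one_mul,
          ← mul_assoc, hmean, zero_mul, add_zero]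
    _ ≤ _ := Real.cosh_le_exp_half_sq _

/-- McDiarmid's inequality, in the form of a bound on the moment generating function. -/
lemma prodExpect_exp_centered_le {k : ℕ} {p : α → ℝ} (hp : p ∈ stdSimplex ℝ α)
    {g : (Fin k → α) → ℝ} {c : ℝ}
    (hg : ∀ x i a, |g (Function.update x i a) - g x| ≤ c) (t : ℝ) :
    prodExpect (fun _ => p) (fun x => Real.exp (t * (g x - prodExpect (fun _ => p) g)))
      ≤ Real.exp (k * ((t * c) ^ 2 / 2)) := by
  induction k with
  | zero => simp [prodExpect]
  | succ k ih =>
    set h : α → ℝ := fun a => prodExpect (fun _ : Fin k => p) (fun x => g (Fin.cons a x)) with hh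
    have hgh : prodExpect (fun _ => p) g = ∑ a, p a * h a := prodExpect_succ p g
    -- conditioning on the first coordinate preserves bounded differences
    have hdiff : ∀ a b, |h a - h b| ≤ c := by
      intro a b
      have hpt : ∀ x : Fin k → α, |g (Fin.cons a x) - g (Fin.cons b x)| ≤ c := by
        intro x
        simpa using hg (Fin.cons b x) 0 a
      simp only [hh]
      rw [← prodExpect_sub, abs_le]
      constructor
      · rw [← prodExpect_const (fun _ : Fin k => hp) (-c)]
        exact prodExpect_mono (fun _ => hp) fun x => (abs_le.1 (hpt x)).1
      · rw [← prodExpect_const (fun _ : Fin k => hp) c]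
        exact prodExpect_mono (fun _ => hp) fun x => (abs_le.1 (hpt x)).2
    rw [prodExpect_succ, hgh]
    calc ∑ a, p a * prodExpect (fun _ : Fin k => p)
            (fun x => Real.exp (t * (g (Fin.cons a x) - ∑ b, p b * h b)))
        ≤ ∑ a, p a * (Real.exp (t * (h a - ∑ b, p b * h b))
            * Real.exp (k * ((t * c) ^ 2 / 2))) := by
          refine Finset.sum_le_sum fun a _ => mul_le_mul_of_nonneg_left ?_ (hp.1 a)
          have hsplit : ∀ x : Fin k → α,
              Real.exp (t * (g (Fin.cons a x) - ∑ b, p b * h b))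
                = Real.exp (t * (h a - ∑ b, p b * h b))
                  * Real.exp (t * (g (Fin.cons a x) - h a)) := by
            intro x
            rw [← Real.exp_add]
            ring_nf
          simp only [hsplit]
          rw [prodExpect_const_mul]
          refine mul_le_mul_of_nonneg_left (ih fun x i b => ?_) (Real.exp_nonneg _)
          rw [Fin.cons_update]
          exact hg _ _ _
      _ ≤ Real.exp ((t * c) ^ 2 / 2) * Real.exp (k * ((t * c) ^ 2 / 2)) := by
          simp only [← mul_assoc, ← Finset.sum_mul]
          exact mul_le_mul_of_nonneg_right (sum_mul_exp_centered_le hp hdiff t)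
            (Real.exp_nonneg _)
      _ = Real.exp ((k + 1 : ℕ) * ((t * c) ^ 2 / 2)) := by
          rw [← Real.exp_add]
          push_cast
          ring_nf

/-- Maximal inequality: the expected maximum of finitely many functions with bounded differences
exceeds their largest expectation by little. The maximum is represented by any `Y` that is dominated
pointwise by one of the functions. -/
lemma prodExpect_le_of_forall_exists_le {k : ℕ} {τ : Type*} [Fintype τ] [Nonempty τ] {p : α → ℝ}
    (hp : p ∈ stdSimplex ℝ α) {g : τ → (Fin k → α) → ℝ} {c B t : ℝ} (ht : 0 < t)
    (hg : ∀ s x i a, |g s (Function.update x i a) - g s x| ≤ c)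
    (hB : ∀ s, prodExpect (fun _ => p) (g s) ≤ B) {Y : (Fin k → α) → ℝ}
    (hY : ∀ x, ∃ s, Y x ≤ g s x) :
    prodExpect (fun _ => p) Y ≤ B + Real.log (Fintype.card τ) / t + k * c ^ 2 * t / 2 := by
  set μ := prodExpect (fun _ : Fin k => p) Y with hμ
  have hcard : (0 : ℝ) < Fintype.card τ := by exact_mod_cast Fintype.card_pos
  have jensen : Real.exp (t * (μ - B))
      ≤ prodExpect (fun _ : Fin k => p) (fun x => Real.exp (t * (Y x - B))) := by
    -- the tangent line of `exp` at `t (μ - B)`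
    have hline : ∀ x, Real.exp (t * (μ - B)) + Real.exp (t * (μ - B)) * (t * (Y x - μ))
        ≤ Real.exp (t * (Y x - B)) := by
      intro x
      have h1 : Real.exp (t * (Y x - B))
          = Real.exp (t * (μ - B)) * Real.exp (t * (Y x - μ)) := by
        rw [← Real.exp_add]; ring_nf
      rw [h1]
      nlinarith [Real.add_one_le_exp (t * (Y x - μ)), Real.exp_pos (t * (μ - B))]
    have h2 := prodExpect_mono (fun _ : Fin k => hp) hline
    rwa [prodExpect_add, prodExpect_const_mul, prodExpect_const_mul, prodExpect_sub,
      prodExpect_const (fun _ => hp), prodExpect_const (fun _ => hp), ← hμ, sub_self, mul_zero,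
      mul_zero, add_zero] at h2
  have hexp : Real.exp (t * (μ - B))
      ≤ Fintype.card τ * Real.exp (k * ((t * c) ^ 2 / 2)) := by
    refine jensen.trans ?_
    calc prodExpect (fun _ : Fin k => p) (fun x => Real.exp (t * (Y x - B)))
        ≤ prodExpect (fun _ : Fin k => p) (fun x => ∑ s,
            Real.exp (t * (g s x - prodExpect (fun _ => p) (g s)))) := by
          refine prodExpect_mono (fun _ => hp) fun x => ?_
          obtain ⟨s, hs⟩ := hY x
          refine le_trans (Real.exp_le_exp.2 (mul_le_mul_of_nonneg_left ?_ ht.le))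
            (Finset.single_le_sum
              (f := fun s => Real.exp (t * (g s x - prodExpect (fun _ => p) (g s))))
              (fun _ _ => Real.exp_nonneg _) (Finset.mem_univ s))
          linarith [hB s]
      _ ≤ ∑ _s : τ, Real.exp (k * ((t * c) ^ 2 / 2)) := by
          rw [prodExpect_sum]
          exact Finset.sum_le_sum fun s _ => prodExpect_exp_centered_le hp (hg s) t
      _ = _ := by simp
  have hlog := Real.log_le_log (Real.exp_pos _) hexp
  rw [Real.log_exp, Real.log_mul hcard.ne' (Real.exp_ne_zero _), Real.log_exp] at hlog
  have : μ - B ≤ (Real.log (Fintype.card τ) + k * ((t * c) ^ 2 / 2)) / t := by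
    rw [le_div_iff₀ ht]; linarith
  have h3 : (Real.log (Fintype.card τ) + k * ((t * c) ^ 2 / 2)) / t
      = Real.log (Fintype.card τ) / t + k * c ^ 2 * t / 2 := by
    field_simp
  linarith

end Concentration

/-! ### Contaminated empirical distributions -/

section Empirical

variable {X : Type*} [Fintype X]

lemma toReal_mem_stdSimplex (D : PMF X) : (fun x => (D x).toReal) ∈ stdSimplex ℝ X := by
  refine ⟨fun x => ENNReal.toReal_nonneg, ?_⟩
  rw [← ENNReal.toReal_sum fun x _ => D.apply_ne_top x, ← tsum_fintype (L := .unconditional X),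
    D.tsum_coe, ENNReal.toReal_one]

lemma exists_pmf_toReal_eq {q : X → ℝ} (hq : q ∈ stdSimplex ℝ X) :
    ∃ E : PMF X, ∀ x, (E x).toReal = q x := by
  refine ⟨PMF.ofFintype (fun x => ENNReal.ofReal (q x)) ?_, fun x => ?_⟩
  · rw [← ENNReal.ofReal_sum_of_nonneg fun x _ => hq.1 x, hq.2, ENNReal.ofReal_one]
  · rw [PMF.ofFintype_apply, ENNReal.toReal_ofReal (hq.1 x)]

lemma mixture_mem_stdSimplex {d e : X → ℝ} (hd : d ∈ stdSimplex ℝ X) (he : e ∈ stdSimplex ℝ X)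
    {a b : ℝ} (ha : 0 ≤ a) (hb : 0 ≤ b) (hab : a + b = 1) :
    (fun x => a * d x + b * e x) ∈ stdSimplex ℝ X :=
  convex_stdSimplex ℝ X hd he ha hb hab

lemma sum_abs_mixture_sub_le {d e : X → ℝ} (hd : d ∈ stdSimplex ℝ X) (he : e ∈ stdSimplex ℝ X)
    {a b a' b' c : ℝ} (ha : |a - a'| ≤ c) (hb : |b - b'| ≤ c) :
    ∑ x, |(a * d x + b * e x) - (a' * d x + b' * e x)| ≤ 2 * c := by
  calc ∑ x, |(a * d x + b * e x) - (a' * d x + b' * e x)|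
      ≤ ∑ x, (c * d x + c * e x) := by
        refine Finset.sum_le_sum fun x _ => ?_
        have h1 := mul_le_mul_of_nonneg_right ha (hd.1 x)
        have h2 := mul_le_mul_of_nonneg_right hb (he.1 x)
        calc |(a * d x + b * e x) - (a' * d x + b' * e x)|
            = |(a - a') * d x + (b - b') * e x| := by ring_nf
          _ ≤ |(a - a') * d x| + |(b - b') * e x| := abs_add_le _ _
          _ ≤ _ := by
            rw [abs_mul, abs_mul, abs_of_nonneg (hd.1 x), abs_of_nonneg (he.1 x)]
            linarith
    _ = 2 * c := by
        rw [Finset.sum_add_distrib, ← Finset.mul_sum, ← Finset.mul_sum, hd.2, he.2]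
        ring

variable [DecidableEq X]

/-- The number of occurrences of each point of `X` in the sample `S`, as a real number. -/
def counts {k : ℕ} (S : Fin k → X) (x : X) : ℝ :=
  ∑ i, (Pi.single (S i) 1 : X → ℝ) x

lemma counts_nonneg {k : ℕ} (S : Fin k → X) (x : X) : 0 ≤ counts S x :=
  Finset.sum_nonneg fun i _ => (single_mem_stdSimplex ℝ (S i)).1 x

lemma sum_counts {k : ℕ} (S : Fin k → X) : ∑ x, counts S x = k := by
  simp only [counts]
  rw [Finset.sum_comm, Finset.sum_congr rfl fun i _ => (single_mem_stdSimplex ℝ (S i)).2]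
  simp

/-- The distribution giving weight `a` to each point of the sample `S` and weight `b` to each point
of the sample `T`. -/
def blend {k r : ℕ} (a b : ℝ) (S : Fin k → X) (T : Fin r → X) (x : X) : ℝ :=
  a * counts S x + b * counts T x

lemma blend_mem_stdSimplex {k r : ℕ} {a b : ℝ} (ha : 0 ≤ a) (hb : 0 ≤ b) (hab : k * a + r * b = 1)
    (S : Fin k → X) (T : Fin r → X) : blend a b S T ∈ stdSimplex ℝ X := by
  refine ⟨fun x => add_nonneg (mul_nonneg ha (counts_nonneg S x)) (mul_nonneg hb
    (counts_nonneg T x)), ?_⟩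
  simp only [blend]
  rw [Finset.sum_add_distrib, ← Finset.mul_sum, ← Finset.mul_sum, sum_counts, sum_counts]
  linarith

lemma inv_mul_counts_mem_stdSimplex {r : ℕ} (hr : 0 < r) (T : Fin r → X) :
    (fun x => 1 / (r : ℝ) * counts T x) ∈ stdSimplex ℝ X := by
  refine ⟨fun x => mul_nonneg (by positivity) (counts_nonneg T x), ?_⟩
  rw [← Finset.mul_sum, sum_counts]
  have : (r : ℝ) ≠ 0 := by positivity
  field_simp

/-- The empirical distribution of `T`, multiplied out so that the empty sample is covered too. -/
lemma exists_mul_eq_counts {l : ℕ} (T : Fin l → X) {d : X → ℝ} (hd : d ∈ stdSimplex ℝ X) :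
    ∃ q ∈ stdSimplex ℝ X, ∀ x, (l : ℝ) * q x = counts T x := by
  rcases Nat.eq_zero_or_pos l with rfl | hl
  · exact ⟨d, hd, fun x => by simp [counts]⟩
  · refine ⟨_, inv_mul_counts_mem_stdSimplex hl T, fun x => ?_⟩
    have : (l : ℝ) ≠ 0 := by positivity
    field_simp

lemma sum_abs_blend_update_sub_le {k r : ℕ} {a : ℝ} (ha : 0 ≤ a) (b : ℝ) (S : Fin k → X)
    (T : Fin r → X) (i : Fin k) (y : X) :
    ∑ x, |blend a b (Function.update S i y) T x - blend a b S T x| ≤ 2 * a := by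
  have h : ∀ x, counts (Function.update S i y) x - counts S x
      = (Pi.single y 1 : X → ℝ) x - (Pi.single (S i) 1 : X → ℝ) x := by
    intro x
    rw [counts, counts, ← Finset.sum_sub_distrib, Finset.sum_eq_single i]
    · rw [Function.update_self]
    · intro j _ hj
      rw [Function.update_of_ne hj, sub_self]
    · simp
  calc ∑ x, |blend a b (Function.update S i y) T x - blend a b S T x|
      = ∑ x, |(a * (Pi.single y 1 : X → ℝ) x + 0 * (Pi.single (S i) 1 : X → ℝ) x)
          - (0 * (Pi.single y 1 : X → ℝ) x + a * (Pi.single (S i) 1 : X → ℝ) x)| := by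
        refine Finset.sum_congr rfl fun x _ => ?_
        congr 1
        simp only [blend]
        linear_combination a * h x
    _ ≤ 2 * a := by
        refine sum_abs_mixture_sub_le (single_mem_stdSimplex ℝ y) (single_mem_stdSimplex ℝ (S i))
          ?_ ?_
        · rw [sub_zero, abs_of_nonneg ha]
        · rw [zero_sub, abs_neg, abs_of_nonneg ha]

/-- Resampling from a blend of two independent samples, with independent but not necessarily
identically distributed entries, against drawing from the corresponding mixture. Deterministic
samples are allowed. -/
lemma abs_prodExpect_blend_sub_le {n k r : ℕ} {a b : ℝ} (ha : 0 ≤ a) (hb : 0 ≤ b)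
    (hab : k * a + r * b = 1) {p : Fin k → X → ℝ} (hp : ∀ i, p i ∈ stdSimplex ℝ X)
    {q : Fin r → X → ℝ} (hq : ∀ i, q i ∈ stdSimplex ℝ X) {g : (Fin n → X) → ℝ}
    (hg : ∀ x, g x ∈ Set.Icc (0 : ℝ) 1) :
    |prodExpect p (fun S => prodExpect q (fun T => prodExpect (fun _ : Fin n => blend a b S T) g))
        - prodExpect (fun _ : Fin n => fun x => a * ∑ i, p i x + b * ∑ j, q j x) g|
      ≤ (n : ℝ) ^ 2 * (k * a ^ 2 + r * b ^ 2) := by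
  set w : Fin k ⊕ Fin r → ℝ := Sum.elim (fun _ => a) (fun _ => b) with hw
  have hws : w ∈ stdSimplex ℝ (Fin k ⊕ Fin r) := by
    refine ⟨?_, by simp [hw, hab]⟩
    rintro (i | j) <;> simpa [hw]
  have hpq : ∀ i, Sum.elim p q i ∈ stdSimplex ℝ X := by
    rintro (i | j)
    exacts [hp i, hq j]
  have h := abs_prodExpect_resample_sub_le hws hpq hg
  rw [prodExpect_sumElim] at h
  simp only [hw, Fintype.sum_sum_type, Sum.elim_inl, Sum.elim_inr, ← Finset.mul_sum, Finset.sum_const,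
    Finset.card_univ, Fintype.card_fin, nsmul_eq_mul] at h
  exact h

end Empirical

/-! ### The two adversaries -/

section Adversaries

variable {X : Type*} {n m : ℕ}

/-- The indicator function of the event that the test `f` accepts. -/
def acceptIndicator (f : (Fin n → X) → Bool) (x : Fin n → X) : ℝ :=
  if f x then 1 else 0

lemma acceptIndicator_mem_Icc (f : (Fin n → X) → Bool) (x : Fin n → X) :
    acceptIndicator f x ∈ Set.Icc (0 : ℝ) 1 := by
  unfold acceptIndicator
  split_ifs <;> simp

lemma compSubsample_true_toReal (f : (Fin n → X) → Bool) (h : n ≤ m) (S : Fin m → X) :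
    (compSubsample f h S true).toReal
      = (∑ φ : Fin n ↪ Fin m, acceptIndicator f (S ∘ φ)) / Fintype.card (Fin n ↪ Fin m) := by
  have : Nonempty (Fin n ↪ Fin m) := ⟨Fin.castLEEmb h⟩
  rw [compSubsample, subsample, PMF.map_comp, PMF.map_apply, tsum_fintype, ENNReal.toReal_sum,
    Finset.sum_div]
  · refine Finset.sum_congr rfl fun φ _ => ?_
    simp only [Function.comp_apply, PMF.uniformOfFintype_apply, acceptIndicator]
    change ENNReal.toReal (if true = f (S ∘ φ) then _ else _) = _
    cases f (S ∘ φ) <;> simp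
  · intro φ _
    split_ifs
    · exact PMF.apply_ne_top _ _
    · simp

variable [Fintype X]

lemma expect_iid (D : PMF X) (k : ℕ) (g : (Fin k → X) → ℝ) :
    expect (iid D k) g = prodExpect (fun _ => fun x => (D x).toReal) g := by
  simp only [expect, iid, prodExpect, PMF.ofFintype_apply, ENNReal.toReal_prod]

/-- The acceptance probability of `f` on `n` independent draws from the weight function `p`. -/
def acceptProb (f : (Fin n → X) → Bool) (p : X → ℝ) : ℝ :=
  prodExpect (fun _ => p) (acceptIndicator f)

lemma acceptProb_mem_Icc (f : (Fin n → X) → Bool) {p : X → ℝ} (hp : p ∈ stdSimplex ℝ X) :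
    acceptProb f p ∈ Set.Icc (0 : ℝ) 1 :=
  prodExpect_mem_Icc (fun _ => hp) (acceptIndicator_mem_Icc f)

/-- Running `f` on a subsample of the contaminated sample is close to running it on independent
draws from the contaminated empirical distribution. -/
lemma abs_compSubsample_sub_acceptProb_le [DecidableEq X] {k l : ℕ} (hm : 0 < m)
    (f : (Fin n → X) → Bool) (h : n ≤ m) (S : Fin k → X) (T : Fin l → X)
    (σ : Fin m ≃ Fin k ⊕ Fin l) :
    |(compSubsample f h (fun i => Sum.elim S T (σ i)) true).toReal
        - acceptProb f (blend (1 / (m : ℝ)) (1 / (m : ℝ)) S T)| ≤ (n : ℝ) ^ 2 / m := by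
  set S' : Fin m → X := fun i => Sum.elim S T (σ i) with hS'
  have hblend : blend (1 / (m : ℝ)) (1 / (m : ℝ)) S T
      = fun x => ∑ i, 1 / (m : ℝ) * (Pi.single (S' i) 1 : X → ℝ) x := by
    funext x
    rw [← Finset.mul_sum, blend, ← mul_add, hS',
      Equiv.sum_comp σ (fun i => (Pi.single (Sum.elim S T i) 1 : X → ℝ) x), Fintype.sum_sum_type]
    rfl
  have hmix := prodExpect_mixture (ι := Fin n) (fun _ : Fin m => 1 / (m : ℝ))
    (fun i => (Pi.single (S' i) 1 : X → ℝ)) (acceptIndicator f)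
  have hpt : ∀ φ : Fin n → Fin m,
      prodExpect (fun j => (Pi.single (S' (φ j)) 1 : X → ℝ)) (acceptIndicator f)
        = acceptIndicator f (S' ∘ φ) := fun φ => prodExpect_single (S' ∘ φ) _
  simp only [hpt] at hmix
  rw [acceptProb, hblend, hmix, compSubsample_true_toReal]
  exact abs_expect_embedding_sub_le hm h (g := fun φ => acceptIndicator f (S' ∘ φ))
    fun φ => acceptIndicator_mem_Icc f _

lemma obliviousAddMax_le {η : ℝ} (f : (Fin n → X) → Bool) (D : PMF X) {B : ℝ}
    (hB : ∀ e ∈ stdSimplex ℝ X, acceptProb f (fun x => (1 - η) * (D x).toReal + η * e x) ≤ B) :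
    obliviousAddMax η f D ≤ B := by
  have : Nonempty (obliviousAdd η D) := ⟨⟨D, D, fun x => by ring⟩⟩
  refine ciSup_le ?_
  rintro ⟨D', E, hE⟩
  rw [expect_iid]
  simp only [hE]
  exact hB _ (toReal_mem_stdSimplex E)

lemma acceptProb_le_obliviousAddMax {η : ℝ} (f : (Fin n → X) → Bool) (D : PMF X)
    (hη : η ∈ Set.Ioo (0 : ℝ) 1) {e : X → ℝ} (he : e ∈ stdSimplex ℝ X) :
    acceptProb f (fun x => (1 - η) * (D x).toReal + η * e x) ≤ obliviousAddMax η f D := by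
  obtain ⟨E, hE⟩ := exists_pmf_toReal_eq he
  obtain ⟨D', hD'⟩ := exists_pmf_toReal_eq
    (mixture_mem_stdSimplex (toReal_mem_stdSimplex D) he (sub_nonneg.2 hη.2.le) hη.1.le
      (sub_add_cancel 1 η))
  have hmem : D' ∈ obliviousAdd η D := ⟨E, fun x => by rw [hD', hE]⟩
  have hbdd : BddAbove (Set.range fun D' : obliviousAdd η D =>
      expect (iid (D' : PMF X) n) (fun S' => if f S' then 1 else 0)) := by
    refine ⟨1, ?_⟩
    rintro _ ⟨D'', rfl⟩
    simp only [expect_iid]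
    exact (acceptProb_mem_Icc f (toReal_mem_stdSimplex _)).2
  refine le_trans (le_of_eq ?_) (le_ciSup hbdd ⟨D', hmem⟩)
  simp only [expect_iid, hD']
  rfl

/-- The rounded numbers of clean and added points. -/
lemma clean_added_card {η : ℝ} (hη : η ∈ Set.Ioo (0 : ℝ) 1) (m : ℕ) :
    ⌈(1 - η) * m⌉₊ + ⌊η * m⌋₊ = m ∧ |(⌈(1 - η) * m⌉₊ : ℝ) - (1 - η) * m| ≤ 1
      ∧ |(⌊η * m⌋₊ : ℝ) - η * m| ≤ 1 := by
  have h0 : 0 ≤ η * m := mul_nonneg hη.1.le (Nat.cast_nonneg m)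
  have h1 : 0 ≤ (1 - η) * m := mul_nonneg (sub_nonneg.2 hη.2.le) (Nat.cast_nonneg m)
  have a1 := Nat.le_ceil ((1 - η) * m)
  have a2 := Nat.ceil_lt_add_one h1
  have b1 := Nat.floor_le h0
  have b2 := Nat.lt_floor_add_one (η * m)
  refine ⟨?_, abs_le.2 ⟨by linarith, by linarith⟩, abs_le.2 ⟨by linarith, by linarith⟩⟩
  have c1 : ((⌈(1 - η) * m⌉₊ + ⌊η * m⌋₊ : ℕ) : ℝ) < (m + 1 : ℕ) := by push_cast; linarith
  have c2 : (m : ℝ) < (⌈(1 - η) * m⌉₊ + ⌊η * m⌋₊ + 1 : ℕ) := by push_cast; linarith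
  have c1' := Nat.cast_lt.1 c1
  have c2' := Nat.cast_lt.1 c2
  omega

/-- Rounding the fraction of added points changes acceptance probabilities by little. -/
lemma abs_acceptProb_rounding_le {η : ℝ} (hη : η ∈ Set.Ioo (0 : ℝ) 1) (hm : 0 < m)
    (f : (Fin n → X) → Bool) {d e : X → ℝ} (hd : d ∈ stdSimplex ℝ X) (he : e ∈ stdSimplex ℝ X) :
    |acceptProb f (fun x => (⌈(1 - η) * m⌉₊ / m : ℝ) * d x + (⌊η * m⌋₊ / m : ℝ) * e x)
        - acceptProb f (fun x => (1 - η) * d x + η * e x)| ≤ n * (2 * (1 / m)) := by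
  obtain ⟨hkl, hk, hl⟩ := clean_added_card hη m
  have hm' : (0 : ℝ) < m := by exact_mod_cast hm
  have hkl' : (⌈(1 - η) * m⌉₊ : ℝ) + ⌊η * m⌋₊ = m := by exact_mod_cast hkl
  refine (abs_prodExpect_sub_le
    (mixture_mem_stdSimplex hd he (by positivity) (by positivity) ?_)
    (mixture_mem_stdSimplex hd he (sub_nonneg.2 hη.2.le) hη.1.le (sub_add_cancel 1 η))
    (acceptIndicator_mem_Icc f)).trans
    (mul_le_mul_of_nonneg_left (sum_abs_mixture_sub_le hd he ?_ ?_) (Nat.cast_nonneg n))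
  · rw [← add_div, hkl', div_self hm'.ne']
  · rw [div_sub' hm'.ne', abs_div, abs_of_pos hm', mul_comm (m : ℝ)]
    exact div_le_div_of_nonneg_right hk hm'.le
  · rw [div_sub' hm'.ne', abs_div, abs_of_pos hm', mul_comm (m : ℝ)]
    exact div_le_div_of_nonneg_right hl hm'.le

lemma bddAbove_range_compSubsample {η : ℝ} (f : (Fin n → X) → Bool) (h : n ≤ m)
    (S : Fin ⌈(1 - η) * m⌉₊ → X) :
    BddAbove (Set.range fun S' : adaptiveAdd η m S =>
      (compSubsample f h (S' : Fin m → X) true).toReal) :=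
  Set.finite_range _ |>.bddAbove

/-- The adaptive adversary can simulate an oblivious one by adding independent draws from its
noise distribution. -/
lemma obliviousAddMax_le_adaptiveAddMax {η : ℝ} (hη : η ∈ Set.Ioo (0 : ℝ) 1) (hm : 0 < m)
    (f : (Fin n → X) → Bool) (h : n ≤ m) (D : PMF X) :
    obliviousAddMax η f D
      ≤ adaptiveAddMax η (compSubsample f h) D + (2 * n ^ 2 / m + 2 * n / m) := by
  classical
  refine obliviousAddMax_le f D fun e he => ?_
  have hd := toReal_mem_stdSimplex D
  have hm' : (0 : ℝ) < m := by exact_mod_cast hm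
  obtain ⟨hkl, -, -⟩ := clean_added_card hη m
  have hround := abs_acceptProb_rounding_le hη hm f hd he
  have hkl' : (⌈(1 - η) * m⌉₊ : ℝ) + ⌊η * m⌋₊ = m := by exact_mod_cast hkl
  rw [adaptiveAddMax, expect_iid]
  set k := ⌈(1 - η) * m⌉₊
  set l := ⌊η * m⌋₊
  set a : ℝ := 1 / m with ha
  have ha0 : 0 ≤ a := by positivity
  have hres := abs_prodExpect_blend_sub_le (n := n) (k := k) (r := l) ha0 ha0
    (by rw [← add_mul, hkl', ha]; field_simp) (fun _ => hd) (fun _ => he)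
    (acceptIndicator_mem_Icc f)
  have hmix : (fun x => a * ∑ _i : Fin k, (D x).toReal + a * ∑ _j : Fin l, e x)
      = fun x => (k / m : ℝ) * (D x).toReal + (l / m : ℝ) * e x := by
    funext x
    simp only [Finset.sum_const, Finset.card_univ, Fintype.card_fin, nsmul_eq_mul, ha]
    ring
  have herr : (n : ℝ) ^ 2 * (k * a ^ 2 + l * a ^ 2) = n ^ 2 / m := by
    rw [← add_mul, hkl', ha]
    field_simp
  rw [hmix, herr] at hres
  let σ : Fin m ≃ Fin k ⊕ Fin l := (finCongr hkl.symm).trans finSumFinEquiv.symm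
  have hsup : ∀ S : Fin k → X, prodExpect (fun _ => e) (fun T : Fin l → X =>
        prodExpect (fun _ : Fin n => blend a a S T) (acceptIndicator f))
      ≤ (⨆ S' : adaptiveAdd η m S, (compSubsample f h (S' : Fin m → X) true).toReal)
        + n ^ 2 / m := by
    intro S
    obtain ⟨T, hT⟩ := exists_prodExpect_le (fun _ => he) (fun T : Fin l → X =>
      prodExpect (fun _ : Fin n => blend a a S T) (acceptIndicator f))
    refine hT.trans ?_
    have h1 := abs_compSubsample_sub_acceptProb_le hm f h S T σ
    have h2 := le_ciSup (bddAbove_range_compSubsample f h S)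
      ⟨fun i => Sum.elim S T (σ i), T, σ, rfl⟩
    have h3 := (abs_le.1 h1).1
    simp only [acceptProb] at h3
    linarith
  have hmono := prodExpect_mono (fun _ => hd) hsup
  rw [prodExpect_add, prodExpect_const (fun _ => hd)] at hmono
  have h1 := (abs_le.1 hround).1
  have h2 := (abs_le.1 hres).1
  have h3 : (2 * n ^ 2 / m + 2 * n / m : ℝ) = n ^ 2 / m + n ^ 2 / m + n * (2 * (1 / m)) := by
    ring
  simp only [acceptProb] at h1 ⊢
  linarith

/-- The points added by the adaptive adversary can be replaced by copies of `r` points of `X`,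
whose number does not depend on the sample size. -/
lemma exists_compSubsample_le_acceptProb_blend [DecidableEq X] {k l r : ℕ} (hm : 0 < m)
    (hr : 0 < r) (hkl : k + l = m) (f : (Fin n → X) → Bool) (h : n ≤ m) {d : X → ℝ}
    (hd : d ∈ stdSimplex ℝ X) (S : Fin k → X) (T : Fin l → X) (σ : Fin m ≃ Fin k ⊕ Fin l) :
    ∃ T' : Fin r → X, (compSubsample f h (fun i => Sum.elim S T (σ i)) true).toReal
      ≤ acceptProb f (blend (1 / (m : ℝ)) (l / (m * r : ℝ)) S T')
        + (n ^ 2 / m + n ^ 2 * (k * (1 / (m : ℝ)) ^ 2 + r * (l / (m * r : ℝ)) ^ 2)) := by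
  have hm' : (0 : ℝ) < m := by exact_mod_cast hm
  have hr' : (0 : ℝ) < r := by exact_mod_cast hr
  have hkl' : (k : ℝ) + l = m := by exact_mod_cast hkl
  obtain ⟨q, hq, hqT⟩ := exists_mul_eq_counts T hd
  have hsub := abs_compSubsample_sub_acceptProb_le hm f h S T σ
  have hres := abs_prodExpect_blend_sub_le (n := n) (k := k) (r := r) (a := 1 / (m : ℝ))
    (b := l / (m * r : ℝ)) (by positivity) (by positivity)
    (by rw [← hkl']; rw [← hkl'] at hm'; field_simp)
    (fun i => single_mem_stdSimplex ℝ (S i)) (fun _ => hq) (acceptIndicator_mem_Icc f)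
  have hmix : (fun x => 1 / (m : ℝ) * ∑ i, (Pi.single (S i) 1 : X → ℝ) x
        + l / (m * r : ℝ) * ∑ _j : Fin r, q x)
      = blend (1 / (m : ℝ)) (1 / (m : ℝ)) S T := by
    funext x
    simp only [Finset.sum_const, Finset.card_univ, Fintype.card_fin, nsmul_eq_mul, blend,
      ← hqT x]
    simp only [counts]
    field_simp
  rw [prodExpect_single, hmix] at hres
  obtain ⟨T', hT'⟩ := exists_prodExpect_le (fun _ => hq) (fun T' : Fin r → X =>
    prodExpect (fun _ : Fin n => blend (1 / (m : ℝ)) (l / (m * r : ℝ)) S T') (acceptIndicator f))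
  refine ⟨T', ?_⟩
  have h1 := (abs_le.1 hsub).2
  have h2 := (abs_le.1 hres).1
  simp only [acceptProb] at h1 ⊢
  linarith

/-- The adaptive adversary gains little over the oblivious one: it may be restricted to a family of
`|X| ^ r` contaminations, each of which does not depend on the clean sample, and concentration
together with a union bound controls them simultaneously. -/
lemma adaptiveAddMax_le_obliviousAddMax {η : ℝ} (hη : η ∈ Set.Ioo (0 : ℝ) 1) (hm : 0 < m)
    (f : (Fin n → X) → Bool) (h : n ≤ m) (D : PMF X) {r : ℕ} (hr : 0 < r) {t : ℝ} (ht : 0 < t) :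
    adaptiveAddMax η (compSubsample f h) D
      ≤ obliviousAddMax η f D + (3 * n ^ 2 / m + 2 * n ^ 2 / r + 2 * n / m
        + r * Real.log (Fintype.card X) / t + 2 * n ^ 2 * t / m) := by
  classical
  have hd := toReal_mem_stdSimplex D
  have hm' : (0 : ℝ) < m := by exact_mod_cast hm
  have hr' : (0 : ℝ) < r := by exact_mod_cast hr
  obtain ⟨hkl, -, -⟩ := clean_added_card hη m
  have hkl' : (⌈(1 - η) * m⌉₊ : ℝ) + ⌊η * m⌋₊ = m := by exact_mod_cast hkl
  have hround := fun e he => abs_acceptProb_rounding_le (e := e) hη hm f hd he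
  rw [adaptiveAddMax, expect_iid]
  set k := ⌈(1 - η) * m⌉₊
  set l := ⌊η * m⌋₊
  have hX : Nonempty X := by
    by_contra hX
    have := not_nonempty_iff.1 hX
    simpa using hd.2
  set a : ℝ := 1 / m with ha
  set b : ℝ := l / (m * r) with hb
  have ha0 : 0 ≤ a := by positivity
  have hb0 : 0 ≤ b := by positivity
  have hrb : r * b = l / m := by rw [hb]; field_simp
  have hab : k * a + r * b = 1 := by
    rw [hrb, ha, ← hkl']; rw [← hkl'] at hm'; field_simp
  have hkm : (k : ℝ) ≤ m := by linarith [Nat.cast_nonneg (α := ℝ) l]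
  have hlm : (l : ℝ) / m ≤ 1 := (div_le_one hm').2 (by linarith [Nat.cast_nonneg (α := ℝ) k])
  have hlm0 : 0 ≤ (l : ℝ) / m := by positivity
  set w : ℝ := n ^ 2 * (k * a ^ 2 + r * b ^ 2) with hw
  have hwle : w ≤ n ^ 2 / m + n ^ 2 / r := by
    have h1 : k * a ^ 2 ≤ 1 / m := by
      have : k * a ^ 2 = k / m * (1 / m) := by rw [ha]; ring
      rw [this]
      exact mul_le_of_le_one_left (by positivity) ((div_le_one hm').2 hkm)
    have h2 : r * b ^ 2 ≤ 1 / r := by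
      have : r * b ^ 2 = (l / m) ^ 2 * (1 / r) := by rw [hb]; field_simp
      rw [this]
      exact mul_le_of_le_one_left (by positivity) (pow_le_one₀ hlm0 hlm)
    calc w ≤ n ^ 2 * (1 / m + 1 / r) :=
          mul_le_mul_of_nonneg_left (add_le_add h1 h2) (sq_nonneg _)
      _ = _ := by ring
  have hblend : ∀ (S : Fin k → X) (T : Fin r → X), blend a b S T ∈ stdSimplex ℝ X :=
    blend_mem_stdSimplex ha0 hb0 hab
  have hmax := prodExpect_le_of_forall_exists_le (k := k) (τ := Fin r → X) hd
    (g := fun T S => acceptProb f (blend a b S T)) (c := n * (2 * a)) (t := t)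
    (B := obliviousAddMax η f D + n * (2 * (1 / m)) + w) ht ?_ ?_
    (Y := fun S => (⨆ S' : adaptiveAdd η m S, (compSubsample f h (S' : Fin m → X) true).toReal)
      - (n ^ 2 / m + w)) ?_
  · rw [prodExpect_sub, prodExpect_const (fun _ => hd)] at hmax
    have hlog : Real.log (Fintype.card (Fin r → X)) = r * Real.log (Fintype.card X) := by
      rw [Fintype.card_fun, Fintype.card_fin, Nat.cast_pow, Real.log_pow]
    have hkc : k * (n * (2 * a)) ^ 2 * t / 2 ≤ 2 * n ^ 2 * t / m := by
      have : k * (n * (2 * a)) ^ 2 * t / 2 = k / m * (2 * n ^ 2 * t / m) := by rw [ha]; ring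
      rw [this]
      exact mul_le_of_le_one_left (by positivity) ((div_le_one hm').2 hkm)
    have hsplit : (3 * n ^ 2 / m + 2 * n ^ 2 / r + 2 * n / m : ℝ)
        = n ^ 2 / m + 2 * (n ^ 2 / m + n ^ 2 / r) + n * (2 * (1 / m)) := by ring
    rw [hlog] at hmax
    linarith
  · intro T S i y
    exact (abs_prodExpect_sub_le (hblend _ _) (hblend _ _) (acceptIndicator_mem_Icc f)).trans
      (mul_le_mul_of_nonneg_left (sum_abs_blend_update_sub_le ha0 b S T i y) (Nat.cast_nonneg n))
  · intro T
    have he := inv_mul_counts_mem_stdSimplex hr T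
    have hres := abs_prodExpect_blend_sub_le (n := n) ha0 hb0 hab (fun _ : Fin k => hd)
      (fun j => single_mem_stdSimplex ℝ (T j)) (acceptIndicator_mem_Icc f)
    simp only [prodExpect_single] at hres
    have hmix : (fun x => a * ∑ _i : Fin k, (D x).toReal
          + b * ∑ j, (Pi.single (T j) 1 : X → ℝ) x)
        = fun x => (k / m : ℝ) * (D x).toReal + (l / m : ℝ) * (1 / (r : ℝ) * counts T x) := by
      funext x
      simp only [Finset.sum_const, Finset.card_univ, Fintype.card_fin, nsmul_eq_mul, ha, hb,
        counts]
      field_simp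
    rw [hmix] at hres
    have h1 := (abs_le.1 hres).2
    have h2 := (abs_le.1 (hround _ he)).2
    have h3 := acceptProb_le_obliviousAddMax f D hη he
    simp only [acceptProb] at h2 h3 ⊢
    linarith
  · intro S
    have : Nonempty (adaptiveAdd η m S) :=
      ⟨⟨_, fun _ => hX.some, (finCongr hkl.symm).trans finSumFinEquiv.symm, rfl⟩⟩
    obtain ⟨⟨S', T, σ, hS'⟩, hmax⟩ := exists_eq_ciSup_of_finite
      (f := fun S' : adaptiveAdd η m S => (compSubsample f h (S' : Fin m → X) true).toReal)
    obtain ⟨T', hT'⟩ := exists_compSubsample_le_acceptProb_blend hm hr hkl f h hd S T σ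
    refine ⟨T', ?_⟩
    subst hS'
    rw [← hmax]
    linarith

end Adversaries

end AdditiveContamination

theorem mainTheorem9 :
    ∃ P : MvPolynomial (Fin 3) ℝ,
      ∀ (X : Type*) [Fintype X] (n : ℕ) (ε η : ℝ), ε ∈ Set.Ioo (0 : ℝ) 1 → η ∈ Set.Ioo (0 : ℝ) 1 →
      ∀ m : ℕ, MvPolynomial.eval ![(n : ℝ), 1 / ε, Real.log (Fintype.card X)] P ≤ (m : ℝ) →
      ∃ h : n ≤ m, ∀ (f : (Fin n → X) → Bool) (D : PMF X),
        |AdditiveContamination.obliviousAddMax η f D -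
          AdditiveContamination.adaptiveAddMax η (AdditiveContamination.compSubsample f h) D| ≤ ε := by
  -- the first term pays for the maximal inequality over `|X| ^ r` contaminations with
  -- `r ≤ 8 n² / ε + 2`, the second for resampling and rounding, and the others give `n ≤ m`, `0 < m`
  refine ⟨.C 32 * .X 0 ^ 2 * (.C 8 * .X 0 ^ 2 * .X 1 + .C 2) * (.X 2 + .C 1) * .X 1 ^ 2
    + .C 20 * .X 0 ^ 2 * .X 1 + .X 0 + .C 1, ?_⟩
  intro X _ n ε η hε hη m hP
  set L := Real.log (Fintype.card X) with hL
  have hL0 : 0 ≤ L := Real.log_natCast_nonneg _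
  have hε0 := hε.1
  have hn0 : (0 : ℝ) ≤ n := Nat.cast_nonneg n
  simp only [map_add, map_mul, map_pow, MvPolynomial.eval_C, MvPolynomial.eval_X,
    Matrix.cons_val_zero, Matrix.cons_val_one, Matrix.cons_val] at hP
  set A : ℝ := 32 * n ^ 2 * (8 * n ^ 2 * (1 / ε) + 2) * (L + 1) * (1 / ε) ^ 2 with hA
  set B : ℝ := 20 * n ^ 2 * (1 / ε) with hB
  have hA0 : 0 ≤ A := by positivity
  have hB0 : 0 ≤ B := by positivity
  have hm' : (0 : ℝ) < m := by linarith
  have hm : 0 < m := by exact_mod_cast hm'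
  have h : n ≤ m := by
    have : (n : ℝ) ≤ m := by linarith
    exact_mod_cast this
  refine ⟨h, fun f D => ?_⟩
  have hnn : (n : ℝ) ≤ n ^ 2 := by
    rcases Nat.eq_zero_or_pos n with h0 | h0
    · simp [h0]
    · have : (1 : ℝ) ≤ n := by exact_mod_cast h0
      nlinarith
  have hq1 : (n : ℝ) ^ 2 / m ≤ ε / 20 := by
    rw [div_le_iff₀ hm']
    have : ε / 20 * B = n ^ 2 := by rw [hB]; field_simp
    nlinarith
  have hq2 : (n : ℝ) / m ≤ ε / 20 := (div_le_div_of_nonneg_right hnn hm'.le).trans hq1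
  have hlow := AdditiveContamination.obliviousAddMax_le_adaptiveAddMax hη hm f h D
  -- the number `r` of representative added points makes `2 n ^ 2 / r ≤ ε / 4`
  set r : ℕ := ⌈8 * n ^ 2 * (1 / ε)⌉₊ + 1 with hr
  have hr1 : 8 * n ^ 2 * (1 / ε) ≤ r := by
    rw [hr]; push_cast
    linarith [Nat.le_ceil (8 * (n : ℝ) ^ 2 * (1 / ε))]
  have hr2 : (r : ℝ) ≤ 8 * n ^ 2 * (1 / ε) + 2 := by
    rw [hr]; push_cast
    linarith [Nat.ceil_lt_add_one (a := 8 * (n : ℝ) ^ 2 * (1 / ε)) (by positivity)]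
  have hr0 : (0 : ℝ) < r := by rw [hr]; positivity
  -- the parameter `t` of the maximal inequality makes `r L / t ≤ ε / 4`
  set t : ℝ := 4 * r * (L + 1) / ε with ht
  have ht0 : 0 < t := by positivity
  have hup := AdditiveContamination.adaptiveAddMax_le_obliviousAddMax hη hm f h D (r := r)
    (by omega) ht0
  rw [← hL] at hup
  have e1 : 2 * (n : ℝ) ^ 2 / r ≤ ε / 4 := by
    rw [div_le_iff₀ hr0]
    have : ε / 4 * (8 * n ^ 2 * (1 / ε)) = 2 * n ^ 2 := by field_simp; ring
    nlinarith
  have e2 : r * L / t ≤ ε / 4 := by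
    rw [div_le_iff₀ ht0]
    have : ε / 4 * t = r * (L + 1) := by rw [ht]; field_simp
    rw [this]
    nlinarith
  have e3 : 2 * (n : ℝ) ^ 2 * t / m ≤ ε / 4 := by
    rw [div_le_iff₀ hm']
    have h1 : 2 * (n : ℝ) ^ 2 * t ≤ 2 * n ^ 2 * (4 * (8 * n ^ 2 * (1 / ε) + 2) * (L + 1) / ε) := by
      rw [ht]; gcongr
    have h2 : 2 * (n : ℝ) ^ 2 * (4 * (8 * n ^ 2 * (1 / ε) + 2) * (L + 1) / ε) = ε / 4 * A := by
      rw [hA]; field_simp; ring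
    nlinarith
  have s1 : (2 * n ^ 2 / m + 2 * n / m : ℝ) = 2 * (n ^ 2 / m) + 2 * (n / m) := by ring
  have s2 : (3 * n ^ 2 / m : ℝ) = 3 * (n ^ 2 / m) := by ring
  have s3 : (2 * n / m : ℝ) = 2 * (n / m) := by ring
  rw [s1] at hlow
  rw [s2, s3] at hup
  rw [abs_le]
  constructor <;> linarith
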